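/- A locale $X$ is given by its frame of opens $\mathcal O X$; a map of locales $f\colon X\to Y$ is a frame map $f^{-1}\colon\mathcal O Y\to\mathcal O X$, with right adjoint $f_*$. It is open if $f^{-1}$ has a left adjoint $f_!$ with $f_!(U\wedge f^{-1}(V))=f_!(U)\wedge V$ for all $U\in\mathcal O X$, $V\in\mathcal O Y$. It is strongly dense if $f_*(!_X^{-1}(p))\le{}!_Y^{-1}(p)$ for every truth value $p\in\mathcal O 1$, where $!_X\colon X\to 1$ is the map to the terminal locale. A sublocale $A$ of a locale $Y$ is weakly closed if every strongly dense inclusion $A\subseteq B$ into a sublocale $B$ of $Y$ is an isomorphism. A localic relation on $X$ is a sublocale $r\colon R\rightarrowtail X\times X$; its source and target maps are $s=\mathrm{pr}_1\circ r$ and $t=\mathrm{pr}_2\circ r$. It has open cones if $s$ and $t$ are open. It is a localic equivalence relation if it is reflexive ($\Delta\subseteq R$, where $\Delta$ is the diagonal), symmetric ($R=R^{\mathrm{op}}$, where $R^{\mathrm{op}}$ has source $t$ and target $s$), and transitive ($R\circ R\subseteq R$, where $R\circ R$ is the image of $(s\circ\pi_1,\,t\circ\pi_2)\colon R\times_X R\to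 X\times X$, the pullback being taken over $t$ and $s$, with projections $\pi_1,\pi_2$). The quotient map $q\colon X\to X/R$ is the coequaliser of $s$ and $t$ in the category of locales. **Theorem.** Let $R$ be a weakly closed localic equivalence relation with open cones on a locale $X$. Then $R$ is effective: the quotient map $q\colon X\to X/R$ exists, and $R$ is its kernel pair, that is, the square $q\circ s=q\circ t$ is a pullback in the category of locales. -/

import Mathlib

open CategoryTheory CategoryTheory.Limits

universe u

noncomputable section

/-! ## The coproduct of two frames -/

namespace FrameCoprod

variable {L M N : Type u} [Order.Frame L] [Order.Frame M] [Order.Frame N]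

theorem mem_himp_iff (a b : LowerSet (L × M)) (p : L × M) :
    p ∈ a ⇨ b ↔ ∀ q, q ≤ p → q ∈ a → q ∈ b := by
  rw [← LowerSet.Iic_le, le_himp_iff]
  constructor
  · intro h q hq ha
    exact h ⟨hq, ha⟩
  · intro h q hq
    exact h q hq.1 hq.2

end FrameCoprod

/-- The coproduct `L ⊗ M` of two frames, realised as the frame of those down-closed subsets of
`L × M` which are closed under arbitrary joins in each of the two coordinates.  These subsets form
a sublocale set of the frame of all down-closed subsets. -/
def frameCoprodIdeals (L M : Type u) [Order.Frame L] [Order.Frame M] :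
    Sublocale (LowerSet (L × M)) where
  carrier := {D | (∀ (S : Set L) (y : M), (∀ x ∈ S, (x, y) ∈ D) → (sSup S, y) ∈ D) ∧
    (∀ (x : L) (T : Set M), (∀ y ∈ T, (x, y) ∈ D) → (x, sSup T) ∈ D)}
  sInf_mem' := by
    intro s hs
    constructor
    · intro S y h
      rw [LowerSet.mem_sInf_iff]
      intro D hD
      exact (hs hD).1 S y fun x hx => LowerSet.mem_sInf_iff.1 (h x hx) D hD
    · intro x T h
      rw [LowerSet.mem_sInf_iff]
      intro D hD
      exact (hs hD).2 x T fun y hy => LowerSet.mem_sInf_iff.1 (h y hy) D hD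
  himp_mem' := by
    rintro a b ⟨h1, h2⟩
    constructor
    · intro S y h
      rw [FrameCoprod.mem_himp_iff]
      rintro ⟨v, w⟩ ⟨hv, hw⟩ ha
      have e : v = sSup ((fun x => v ⊓ x) '' S) := by
        rw [sSup_image, ← inf_sSup_eq]; exact (inf_eq_left.2 hv).symm
      rw [e]
      refine h1 _ _ ?_
      rintro _ ⟨x, hx, rfl⟩
      exact (FrameCoprod.mem_himp_iff a b _).1 (h x hx) (v ⊓ x, w) ⟨inf_le_right, hw⟩
        (a.lower (show (v ⊓ x, w) ≤ (v, w) from ⟨inf_le_left, le_rfl⟩) ha)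
    · intro x T h
      rw [FrameCoprod.mem_himp_iff]
      rintro ⟨v, w⟩ ⟨hv, hw⟩ ha
      have e : w = sSup ((fun y => w ⊓ y) '' T) := by
        rw [sSup_image, ← inf_sSup_eq]; exact (inf_eq_left.2 hw).symm
      rw [e]
      refine h2 _ _ ?_
      rintro _ ⟨y, hy, rfl⟩
      exact (FrameCoprod.mem_himp_iff a b _).1 (h y hy) (v, w ⊓ y) ⟨hv, inf_le_right⟩
        (a.lower (show (v, w ⊓ y) ≤ (v, w) from ⟨le_rfl, inf_le_left⟩) ha)

/-- The underlying type of the frame `L ⊗ M`. -/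
abbrev FrameCoprod (L M : Type u) [Order.Frame L] [Order.Frame M] : Type u :=
  frameCoprodIdeals L M

namespace FrameCoprod

variable {L M N : Type u} [Order.Frame L] [Order.Frame M] [Order.Frame N]

/-- The basic rectangle `x ⊗ y`: the least element of `L ⊗ M` which contains the pair `(x, y)`. -/
def rect (x : L) (y : M) : FrameCoprod L M :=
  (frameCoprodIdeals L M).restrict (LowerSet.Iic (x, y))

theorem rect_le_iff (x : L) (y : M) (D : FrameCoprod L M) :
    rect x y ≤ D ↔ (x, y) ∈ D.1 := by
  rw [rect, (frameCoprodIdeals L M).giRestrict.gc.le_iff_le, LowerSet.Iic_le]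

theorem rect_inf_rect (x x' : L) (y y' : M) :
    rect x y ⊓ rect x' y' = rect (x ⊓ x') (y ⊓ y') := by
  have e : LowerSet.Iic (x, y) ⊓ LowerSet.Iic (x', y') = LowerSet.Iic (x ⊓ x', y ⊓ y') := by
    rw [← LowerSet.Iic_inf, Prod.mk_inf_mk]
  rw [rect, rect, rect, ← map_inf, e]

theorem rect_sSup_left (S : Set L) (y : M) : rect (sSup S) y = ⨆ x ∈ S, rect x y := by
  apply le_antisymm
  · rw [rect_le_iff]
    refine (⨆ x ∈ S, rect x y : FrameCoprod L M).2.1 S y fun x hx => ?_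
    rw [← rect_le_iff]
    exact le_iSup₂_of_le x hx le_rfl
  · refine iSup₂_le fun x hx => ?_
    rw [rect_le_iff]
    exact (rect (sSup S) y).1.lower (show (x, y) ≤ (sSup S, y) from ⟨le_sSup hx, le_rfl⟩)
      ((rect_le_iff _ _ _).1 le_rfl)

theorem rect_sSup_right (x : L) (T : Set M) : rect x (sSup T) = ⨆ y ∈ T, rect x y := by
  apply le_antisymm
  · rw [rect_le_iff]
    refine (⨆ y ∈ T, rect x y : FrameCoprod L M).2.2 x T fun y hy => ?_
    rw [← rect_le_iff]
    exact le_iSup₂_of_le y hy le_rfl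
  · refine iSup₂_le fun y hy => ?_
    rw [rect_le_iff]
    exact (rect x (sSup T)).1.lower (show (x, y) ≤ (x, sSup T) from ⟨le_rfl, le_sSup hy⟩)
      ((rect_le_iff _ _ _).1 le_rfl)

theorem rect_top_top : rect (⊤ : L) (⊤ : M) = ⊤ := by
  have e : LowerSet.Iic ((⊤ : L), (⊤ : M)) = ⊤ := LowerSet.Iic_top
  rw [rect, e, map_top]

/-- Every element of `L ⊗ M` is the join of the rectangles below it. -/
theorem eq_iSup_rect (D : FrameCoprod L M) : D = ⨆ p ∈ D.1, rect p.1 p.2 := by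
  apply le_antisymm
  · intro p hp
    exact (rect_le_iff p.1 p.2 _).1 (le_iSup₂_of_le (f := fun (p : L × M) (_ : p ∈ D.1) =>
      rect p.1 p.2) p hp le_rfl)
  · exact iSup₂_le fun p hp => (rect_le_iff _ _ _).2 hp

/-- The first coproduct injection, `x ↦ x ⊗ ⊤`. -/
def inl : FrameHom L (FrameCoprod L M) where
  toFun x := rect x ⊤
  map_inf' x x' := by rw [rect_inf_rect, inf_idem]
  map_top' := rect_top_top
  map_sSup' S := by rw [rect_sSup_left, sSup_image]

/-- The second coproduct injection, `y ↦ ⊤ ⊗ y`. -/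
def inr : FrameHom M (FrameCoprod L M) where
  toFun y := rect ⊤ y
  map_inf' y y' := by rw [rect_inf_rect, inf_idem]
  map_top' := rect_top_top
  map_sSup' T := by rw [rect_sSup_right, sSup_image]

theorem inl_inf_inr (x : L) (y : M) : inl x ⊓ inr y = rect x y := by
  change rect x ⊤ ⊓ rect ⊤ y = _
  rw [rect_inf_rect, inf_top_eq, top_inf_eq]

/-- The right adjoint of the copair `[h, k]`. -/
def copairAdj (h : FrameHom L N) (k : FrameHom M N) (n : N) : FrameCoprod L M := by
  refine ⟨⟨{p | h p.1 ⊓ k p.2 ≤ n}, ?_⟩, ?_, ?_⟩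
  · intro p q hqp hp
    exact le_trans (inf_le_inf (OrderHomClass.mono h hqp.1) (OrderHomClass.mono k hqp.2)) hp
  · intro S y hS
    change h (sSup S) ⊓ k y ≤ n
    rw [map_sSup, sSup_inf_eq]
    refine iSup₂_le ?_
    rintro _ ⟨x, hx, rfl⟩
    exact hS x hx
  · intro x T hT
    change h x ⊓ k (sSup T) ≤ n
    rw [map_sSup, inf_sSup_eq]
    refine iSup₂_le ?_
    rintro _ ⟨y, hy, rfl⟩
    exact hT y hy

theorem copair_gc (h : FrameHom L N) (k : FrameHom M N) :
    GaloisConnection (fun D : FrameCoprod L M => ⨆ p ∈ D.1, h p.1 ⊓ k p.2) (copairAdj h k) :=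
  fun _ _ => iSup₂_le_iff

/-- The copair `[h, k] : L ⊗ M → N` of two frame maps, with `[h, k] (x ⊗ y) = h x ⊓ k y`. -/
def copair (h : FrameHom L N) (k : FrameHom M N) : FrameHom (FrameCoprod L M) N where
  toFun D := ⨆ p ∈ D.1, h p.1 ⊓ k p.2
  map_inf' D E := by
    apply le_antisymm
    · refine iSup₂_le fun p hp => le_inf ?_ ?_
      · exact le_iSup₂_of_le (f := fun (p : L × M) (_ : p ∈ D.1) => h p.1 ⊓ k p.2) p hp.1 le_rfl
      · exact le_iSup₂_of_le (f := fun (p : L × M) (_ : p ∈ E.1) => h p.1 ⊓ k p.2) p hp.2 le_rfl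
    · rw [iSup₂_inf_eq]
      refine iSup₂_le fun p hp => ?_
      rw [inf_iSup₂_eq]
      refine iSup₂_le fun q hq => ?_
      refine le_iSup₂_of_le (f := fun (p : L × M) (_ : p ∈ (D ⊓ E).1) => h p.1 ⊓ k p.2)
        (p ⊓ q) ⟨D.1.lower inf_le_left hp, E.1.lower inf_le_right hq⟩ ?_
      change _ ≤ h (p.1 ⊓ q.1) ⊓ k (p.2 ⊓ q.2)
      rw [map_inf, map_inf, inf_inf_inf_comm]
  map_top' := by
    refine top_le_iff.1 ?_
    refine le_iSup₂_of_le (f := fun (p : L × M) (_ : p ∈ (⊤ : FrameCoprod L M).1) =>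
      h p.1 ⊓ k p.2) ⊤ ?_ ?_
    · exact (rect_le_iff ⊤ ⊤ ⊤).1 le_top
    · change _ ≤ h ⊤ ⊓ k ⊤
      rw [map_top, map_top, inf_idem]
  map_sSup' S := by
    rw [sSup_image]
    exact (copair_gc h k).l_sSup

theorem copair_rect (h : FrameHom L N) (k : FrameHom M N) (x : L) (y : M) :
    copair h k (rect x y) = h x ⊓ k y := by
  apply le_antisymm
  · exact (copair_gc h k _ _).2 ((rect_le_iff _ _ _).2 (le_refl (h x ⊓ k y)))
  · exact le_iSup₂_of_le (f := fun (p : L × M) (_ : p ∈ (rect x y).1) => h p.1 ⊓ k p.2) (x, y)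
      ((rect_le_iff _ _ _).1 le_rfl) le_rfl

theorem copair_inl (h : FrameHom L N) (k : FrameHom M N) (x : L) :
    copair h k (inl x) = h x := by
  change copair h k (rect x ⊤) = _
  rw [copair_rect, map_top, inf_top_eq]

theorem copair_inr (h : FrameHom L N) (k : FrameHom M N) (y : M) :
    copair h k (inr y) = k y := by
  change copair h k (rect ⊤ y) = _
  rw [copair_rect, map_top, top_inf_eq]

theorem hom_ext {f g : FrameHom (FrameCoprod L M) N} (hl : ∀ x, f (inl x) = g (inl x))
    (hr : ∀ y, f (inr y) = g (inr y)) : f = g := by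
  ext D
  rw [eq_iSup_rect D]
  simp only [map_iSup, ← inl_inf_inr, map_inf, hl, hr]

end FrameCoprod

namespace Locale

/-! ## Maps of locales -/

/-- The frame map `f⁻¹ : 𝒪 Y → 𝒪 X` underlying a map of locales `f : X ⟶ Y`. -/
def inv {X Y : Locale.{u}} (f : X ⟶ Y) : FrameHom Y X :=
  Frm.Hom.hom f.unop

/-- The map of locales given by a frame map in the opposite direction. -/
def ofFrameHom {X Y : Locale.{u}} (h : FrameHom Y X) : X ⟶ Y :=
  Quiver.Hom.op (Frm.ofHom h)

@[simp] theorem inv_ofFrameHom {X Y : Locale.{u}} (h : FrameHom Y X) : inv (ofFrameHom h) = h :=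
  rfl

@[simp] theorem inv_comp {X Y Z : Locale.{u}} (f : X ⟶ Y) (g : Y ⟶ Z) :
    inv (f ≫ g) = (inv f).comp (inv g) :=
  rfl

@[simp] theorem inv_id (X : Locale.{u}) : inv (𝟙 X) = FrameHom.id X :=
  rfl

theorem hom_ext {X Y : Locale.{u}} {f g : X ⟶ Y} (h : ∀ V, inv f V = inv g V) : f = g :=
  Quiver.Hom.unop_inj (Frm.hom_ext (FrameHom.ext h))

/-- The right adjoint `f_*` of `f⁻¹`. -/
def direct {X Y : Locale.{u}} (f : X ⟶ Y) (U : X) : Y :=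
  sSup {V | inv f V ≤ U}

theorem gc_inv_direct {X Y : Locale.{u}} (f : X ⟶ Y) :
    GaloisConnection (inv f) (direct f) := by
  intro V U
  constructor
  · intro h
    exact le_sSup h
  · intro h
    refine (OrderHomClass.mono (inv f) h).trans ?_
    rw [direct, map_sSup]
    exact sSup_le (by rintro _ ⟨W, hW, rfl⟩; exact hW)

/-- A map of locales `f` is open if `f⁻¹` has a left adjoint satisfying Frobenius reciprocity. -/
def IsOpenMap {X Y : Locale.{u}} (f : X ⟶ Y) : Prop :=
  ∃ e : X → Y, GaloisConnection e (inv f) ∧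
    ∀ (U : X) (V : Y), e (U ⊓ inv f V) = e U ⊓ V

/-! ## Sublocales -/

/-- The inclusion map of a sublocale; its frame map sends `U` to the least element of the
sublocale above `U`. -/
def incl {X : Locale.{u}} (S : Sublocale X) : of S ⟶ X :=
  ofFrameHom (X := of S) S.restrict

/-- The frame map of the inclusion map between two sublocales `S ≤ T` of the same locale. -/
def inclusionHom {X : Locale.{u}} {S T : Sublocale X} (h : S ≤ T) : FrameHom T S where
  toFun b := S.restrict b
  map_inf' a b := by rw [Sublocale.coe_inf, map_inf]
  map_top' := map_top S.restrict
  map_sSup' B := by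
    have gc : GaloisConnection (fun b : T => S.restrict (b : X))
        (fun a : S => (⟨a, h a.2⟩ : T)) := fun b a => S.giRestrict.gc (b : X) a
    rw [sSup_image]
    exact gc.l_sSup

/-- The inclusion map between two sublocales `S ≤ T` of the same locale. -/
def inclusion {X : Locale.{u}} {S T : Sublocale X} (h : S ≤ T) : of S ⟶ of T :=
  ofFrameHom (X := of S) (Y := of T) (inclusionHom h)

theorem inclusion_incl {X : Locale.{u}} {S T : Sublocale X} (h : S ≤ T) :
    inclusion h ≫ incl T = incl S := by
  refine hom_ext fun V => ?_
  change S.restrict (T.restrict V : X) = S.restrict V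
  refine eq_of_forall_ge_iff fun c => ?_
  rw [S.giRestrict.gc.le_iff_le, S.giRestrict.gc.le_iff_le]
  exact T.giRestrict.gc.le_iff_le (b := ⟨c, h c.2⟩)

/-- The image of a map of locales, as a sublocale of the codomain: the elements of the form
`f_* U`, equivalently those fixed by the nucleus `f_* f⁻¹`. -/
def image {X Y : Locale.{u}} (f : X ⟶ Y) : Sublocale Y :=
  Nucleus.toSublocale
    { toFun := fun V => direct f (inv f V)
      map_inf' := fun V W => by rw [map_inf, (gc_inv_direct f).u_inf]
      idempotent' := fun V => by rw [(gc_inv_direct f).l_u_l_eq_l]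
      le_apply' := fun V => (gc_inv_direct f).le_u_l V }

theorem mem_image {X Y : Locale.{u}} (f : X ⟶ Y) (V : Y) :
    V ∈ image f ↔ ∃ U, direct f U = V := by
  constructor
  · rintro ⟨W, hW⟩
    exact ⟨_, hW⟩
  · rintro ⟨U, rfl⟩
    exact ⟨direct f U, (gc_inv_direct f).u_l_u_eq_u U⟩

/-- The equaliser of two maps of locales, as a sublocale: the elements which are saturated for
the relation identifying `f⁻¹ V` with `g⁻¹ V` for all `V`. -/
def equaliser {X Y : Locale.{u}} (f g : X ⟶ Y) : Sublocale X where
  carrier := {s | ∀ (V : Y) (c : X), inv f V ⊓ c ≤ s ↔ inv g V ⊓ c ≤ s}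
  sInf_mem' := by
    intro S hS V c
    rw [le_sInf_iff, le_sInf_iff]
    exact forall₂_congr fun s hs => hS hs V c
  himp_mem' := by
    intro a b hb V c
    rw [le_himp_iff, le_himp_iff, inf_assoc, inf_assoc]
    exact hb V (c ⊓ a)

theorem equaliser_condition {X Y : Locale.{u}} (f g : X ⟶ Y) :
    incl (equaliser f g) ≫ f = incl (equaliser f g) ≫ g := by
  refine hom_ext fun V => ?_
  change (equaliser f g).restrict (inv f V) = (equaliser f g).restrict (inv g V)
  refine eq_of_forall_ge_iff fun s => ?_
  rw [(equaliser f g).giRestrict.gc.le_iff_le, (equaliser f g).giRestrict.gc.le_iff_le]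
  simpa using s.2 V ⊤

theorem incl_mono {X : Locale.{u}} (S : Sublocale X) : Mono (incl S) := by
  constructor
  intro Z f g h
  refine hom_ext fun V => ?_
  have hV : ∀ W : X, inv f (S.restrict W) = inv g (S.restrict W) := fun W =>
    show inv (f ≫ incl S) W = inv (g ≫ incl S) W by rw [h]
  have e : S.restrict (Subtype.val (p := (· ∈ S)) V) = V := Sublocale.restrict_of_mem _
  rw [← e]
  exact hV _

theorem exists_equaliser_lift {X Y Z : Locale.{u}} (f g : X ⟶ Y) (k : Z ⟶ X)
    (w : k ≫ f = k ≫ g) : ∃ l : Z ⟶ of (equaliser f g), l ≫ incl (equaliser f g) = k := by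
  have hw : ∀ V, inv k (inv f V) = inv k (inv g V) := fun V =>
    show inv (k ≫ f) V = inv (k ≫ g) V by rw [w]
  have hmem : ∀ U, direct k U ∈ equaliser f g := by
    intro U V c
    rw [← (gc_inv_direct k).le_iff_le, ← (gc_inv_direct k).le_iff_le, map_inf, map_inf, hw]
  have gc : GaloisConnection (fun s : equaliser f g => inv k (s : X))
      (fun U => (⟨direct k U, hmem U⟩ : equaliser f g)) := fun s U => gc_inv_direct k (s : X) U
  let h : FrameHom (equaliser f g) Z :=
    { toFun := fun s => inv k (s : X)
      map_inf' := fun a b => by rw [Sublocale.coe_inf, map_inf]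
      map_top' := map_top (inv k)
      map_sSup' := fun S => by rw [sSup_image]; exact gc.l_sSup }
  refine ⟨ofFrameHom (Y := of (equaliser f g)) h, hom_ext fun V => ?_⟩
  change inv k ((equaliser f g).restrict V : X) = inv k V
  refine eq_of_forall_ge_iff fun U => ?_
  rw [gc_inv_direct k _ U, gc_inv_direct k _ U]
  exact (equaliser f g).giRestrict.gc.le_iff_le (b := ⟨_, hmem U⟩)

/-! ## Products and pullbacks -/

/-- The product of two locales. -/
def prod (X Y : Locale.{u}) : Locale.{u} :=
  of (FrameCoprod X Y)

/-- The first product projection. -/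
def fst (X Y : Locale.{u}) : prod X Y ⟶ X :=
  ofFrameHom (X := prod X Y) FrameCoprod.inl

/-- The second product projection. -/
def snd (X Y : Locale.{u}) : prod X Y ⟶ Y :=
  ofFrameHom (X := prod X Y) FrameCoprod.inr

/-- The pairing `(f, g) : Z ⟶ X × Y`. -/
def pair {X Y Z : Locale.{u}} (f : Z ⟶ X) (g : Z ⟶ Y) : Z ⟶ prod X Y :=
  ofFrameHom (Y := prod X Y) (FrameCoprod.copair (inv f) (inv g))

@[simp] theorem pair_fst {X Y Z : Locale.{u}} (f : Z ⟶ X) (g : Z ⟶ Y) :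
    pair f g ≫ fst X Y = f :=
  hom_ext fun x => FrameCoprod.copair_inl (inv f) (inv g) x

@[simp] theorem pair_snd {X Y Z : Locale.{u}} (f : Z ⟶ X) (g : Z ⟶ Y) :
    pair f g ≫ snd X Y = g :=
  hom_ext fun y => FrameCoprod.copair_inr (inv f) (inv g) y

theorem prod_hom_ext {X Y Z : Locale.{u}} {f g : Z ⟶ prod X Y}
    (h1 : f ≫ fst X Y = g ≫ fst X Y) (h2 : f ≫ snd X Y = g ≫ snd X Y) : f = g := by
  have : inv f = inv g := FrameCoprod.hom_ext
    (fun x => show inv (f ≫ fst X Y) x = inv (g ≫ fst X Y) x by rw [h1])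
    (fun y => show inv (f ≫ snd X Y) y = inv (g ≫ snd X Y) y by rw [h2])
  exact hom_ext fun V => by rw [this]

/-- `prod X Y` is a product of `X` and `Y` in the category of locales. -/
def prodIsLimit (X Y : Locale.{u}) : IsLimit (BinaryFan.mk (fst X Y) (snd X Y)) :=
  BinaryFan.isLimitMk (fun s => pair s.fst s.snd) (fun s => pair_fst s.fst s.snd)
    (fun s => pair_snd s.fst s.snd)
    (fun s m h1 h2 => prod_hom_ext (by rw [h1]; exact (pair_fst s.fst s.snd).symm)
      (by rw [h2]; exact (pair_snd s.fst s.snd).symm))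

/-- The pullback `X ×_Z Y` of `f : X ⟶ Z` and `g : Y ⟶ Z`, as a sublocale of `X × Y`. -/
def pull {X Y Z : Locale.{u}} (f : X ⟶ Z) (g : Y ⟶ Z) : Sublocale (prod X Y) :=
  equaliser (fst X Y ≫ f) (snd X Y ≫ g)

/-- The first pullback projection. -/
def pullFst {X Y Z : Locale.{u}} (f : X ⟶ Z) (g : Y ⟶ Z) : of (pull f g) ⟶ X :=
  incl (pull f g) ≫ fst X Y

/-- The second pullback projection. -/
def pullSnd {X Y Z : Locale.{u}} (f : X ⟶ Z) (g : Y ⟶ Z) : of (pull f g) ⟶ Y :=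
  incl (pull f g) ≫ snd X Y

theorem pull_isPullback {X Y Z : Locale.{u}} (f : X ⟶ Z) (g : Y ⟶ Z) :
    IsPullback (pullFst f g) (pullSnd f g) f g := by
  refine ⟨⟨?_⟩, ⟨?_⟩⟩
  · simp only [pullFst, pullSnd, Category.assoc]
    exact equaliser_condition (fst X Y ≫ f) (snd X Y ≫ g)
  · have ex : ∀ s : PullbackCone f g, ∃ l : s.pt ⟶ of (pull f g),
        l ≫ incl (pull f g) = pair s.fst s.snd := fun s =>
      exists_equaliser_lift _ _ _ (by
        rw [← Category.assoc, ← Category.assoc, pair_fst, pair_snd]; exact s.condition)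
    refine PullbackCone.IsLimit.mk _ (fun s => (ex s).choose) ?_ ?_ ?_
    · intro s
      rw [pullFst, ← Category.assoc, (ex s).choose_spec, pair_fst]
    · intro s
      rw [pullSnd, ← Category.assoc, (ex s).choose_spec, pair_snd]
    · intro s m h1 h2
      have := incl_mono (pull f g)
      rw [← cancel_mono (incl (pull f g)), (ex s).choose_spec]
      refine prod_hom_ext ?_ ?_
      · rw [pair_fst, ← h1, pullFst, Category.assoc]
      · rw [pair_snd, ← h2, pullSnd, Category.assoc]

/-! ## Strong density and weak closedness -/

/-- The frame map `𝒪 1 → 𝒪 X` of the unique map from `X` to the terminal locale `1`, whose frame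
of opens `𝒪 1` is the frame of truth values. -/
def truth (X : Locale.{u}) : FrameHom Prop X where
  toFun p := ⨆ _ : p, ⊤
  map_inf' p q := by
    by_cases hp : p <;> by_cases hq : q <;> simp [hp, hq]
  map_top' := by simp
  map_sSup' s := by
    apply le_antisymm
    · refine iSup_le fun h => ?_
      obtain ⟨p, hp, h⟩ := (sSup_Prop_eq ▸ h : ∃ p ∈ s, p)
      exact le_sSup_of_le ⟨p, hp, rfl⟩ (le_iSup (fun _ : p => (⊤ : X)) h)
    · refine sSup_le ?_
      rintro _ ⟨p, hp, rfl⟩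
      exact iSup_le fun h => le_iSup (fun _ : sSup s => (⊤ : X)) (le_sSup hp h)

theorem eq_truth (X : Locale.{u}) (h : FrameHom Prop X) : h = truth X := by
  ext p
  by_cases hp : p
  · have e : p = ⊤ := by simpa using hp
    rw [e, map_top, map_top]
  · have e : p = ⊥ := by simpa using hp
    rw [e, map_bot, map_bot]

/-- A map of locales `f : X ⟶ Y` is strongly dense if `f_* (!_X⁻¹ p) ≤ !_Y⁻¹ p` for every truth
value `p`. -/
def StronglyDense {X Y : Locale.{u}} (f : X ⟶ Y) : Prop :=
  ∀ p : Prop, direct f (truth X p) ≤ truth Y p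

/-- A sublocale `A` of `X` is weakly closed if every strongly dense inclusion of `A` in a
sublocale `B` of `X` is an isomorphism. -/
def WeaklyClosed {X : Locale.{u}} (A : Sublocale X) : Prop :=
  ∀ (B : Sublocale X) (h : A ≤ B), StronglyDense (inclusion h) → IsIso (inclusion h)

/-! ## Localic relations -/

/-- A localic relation on `X` is a sublocale of `X × X`. -/
abbrev Relation (X : Locale.{u}) : Type u :=
  Sublocale (prod X X)

namespace Relation

variable {X : Locale.{u}}

/-- The source map of a localic relation. -/
def source (R : Relation X) : of R ⟶ X :=
  incl R ≫ fst X X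

/-- The target map of a localic relation. -/
def target (R : Relation X) : of R ⟶ X :=
  incl R ≫ snd X X

/-- A localic relation has open cones if its source and target maps are open. -/
def HasOpenCones (R : Relation X) : Prop :=
  IsOpenMap R.source ∧ IsOpenMap R.target

/-- The diagonal relation: the image of the diagonal map `X ⟶ X × X`. -/
def diagonal (X : Locale.{u}) : Relation X :=
  image (pair (𝟙 X) (𝟙 X))

/-- The opposite relation, whose source and target are the target and source of `R`. -/
def opposite (R : Relation X) : Relation X :=
  image (pair R.target R.source)

/-- The composite relation: the image in `X × X` of the pullback of the target map of `R` along
the source map of `Q`. -/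
def comp (R Q : Relation X) : Relation X :=
  image (pair (pullFst R.target Q.source ≫ R.source) (pullSnd R.target Q.source ≫ Q.target))

/-- A localic equivalence relation: reflexive, symmetric and transitive. -/
structure IsEquivalence (R : Relation X) : Prop where
  refl : diagonal X ≤ R
  symm : R = R.opposite
  trans : R.comp R ≤ R

/-- `q` is the quotient map `X ⟶ X / R` of `R`: a coequaliser of its source and target maps. -/
def IsQuotientMap (R : Relation X) {Q : Locale.{u}} (q : X ⟶ Q) : Prop :=
  ∃ w : R.source ≫ q = R.target ≫ q, Nonempty (IsColimit (Cofork.ofπ q w))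

end Relation

end Locale

end

/-! Over classical truth values strong density is ordinary density, so a weakly closed `R` is closed
in `X × X`: its complement is the open `W`, the least element of `R`. A map into `X × X` then
factors through `R` as soon as its inverse image kills every rectangle `U ⊗ V` in `W`, that is,
every rectangle with `s⁻¹ U ⊓ t⁻¹ V = ⊥`.

Let `t_!` be the left adjoint of `t⁻¹`, and let `A = t_! (s⁻¹ U)` be the saturation of `U`.
Reflexivity gives `U ≤ A`; Frobenius reciprocity gives `A ⊓ V = ⊥`; Beck–Chevalley for `R ×_X R`,
with transitivity and symmetry, gives `s⁻¹ A = t⁻¹ A` (`inv_source_eq_inv_target`). Hence `A = q⁻¹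
B` for an open `B` of the quotient. If `q ∘ a = q ∘ b`, then `a⁻¹ A = b⁻¹ A`, so `a⁻¹ U ⊓ b⁻¹ V ≤
b⁻¹ (A ⊓ V) = ⊥`, and `(a, b)` factors through `R`.

The quotient itself always exists: its frame is the subframe on which `s⁻¹` and `t⁻¹` agree. -/

noncomputable section

/-! ## The subframe on which two frame maps agree -/

/-- The elements on which two frame maps agree. -/
def FrameEqLocus {L M : Type u} [Order.Frame L] [Order.Frame M] (g h : FrameHom L M) : Type u :=
  {x : L // g x = h x}

namespace FrameEqLocus

variable {L M : Type u} [Order.Frame L] [Order.Frame M] (g h : FrameHom L M)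

instance : PartialOrder (FrameEqLocus g h) :=
  inferInstanceAs (PartialOrder {x : L // g x = h x})

instance : SupSet (FrameEqLocus g h) where
  sSup S := ⟨sSup (Subtype.val '' S), by
    rw [map_sSup, map_sSup]
    congr 1
    refine Set.image_congr ?_
    rintro _ ⟨x, -, rfl⟩
    exact x.2⟩

theorem val_sSup (S : Set (FrameEqLocus g h)) : (sSup S).1 = sSup (Subtype.val '' S) :=
  rfl

theorem isLUB_sSup (S : Set (FrameEqLocus g h)) : IsLUB S (sSup S) := by
  constructor
  · intro x hx
    exact le_sSup (a := x.1) ⟨x, hx, rfl⟩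
  · intro y hy
    refine sSup_le (α := L) ?_
    rintro _ ⟨x, hx, rfl⟩
    exact hy hx

instance : CompleteLattice (FrameEqLocus g h) where
  __ := completeLatticeOfSup (FrameEqLocus g h) (isLUB_sSup g h)
  -- Finite meets are taken from `L` rather than built from joins, so that the inclusion into `L`
  -- preserves them by `rfl`.
  inf x y := ⟨x.1 ⊓ y.1, by rw [map_inf, map_inf, x.2, y.2]⟩
  inf_le_left x y := inf_le_left (a := x.1) (b := y.1)
  inf_le_right x y := inf_le_right (a := x.1) (b := y.1)
  le_inf _ _ _ hy hz := le_inf (α := L) hy hz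
  top := ⟨⊤, by rw [map_top, map_top]⟩
  le_top x := le_top (a := x.1)

theorem val_inf (x y : FrameEqLocus g h) : (x ⊓ y).1 = x.1 ⊓ y.1 :=
  rfl

theorem val_top : (⊤ : FrameEqLocus g h).1 = ⊤ :=
  rfl

instance : Order.Frame (FrameEqLocus g h) :=
  Order.Frame.ofMinimalAxioms
    { inf_sSup_le_iSup_inf := fun a S => by
        change a.1 ⊓ sSup (Subtype.val '' S) ≤ (⨆ b ∈ S, a ⊓ b).1
        rw [inf_sSup_eq]
        refine iSup₂_le ?_
        rintro _ ⟨b, hb, rfl⟩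
        exact (le_iSup₂_of_le b hb le_rfl : a ⊓ b ≤ ⨆ b ∈ S, a ⊓ b) }

/-- The inclusion of the subframe on which two frame maps agree. -/
def subtype : FrameHom (FrameEqLocus g h) L where
  toFun := Subtype.val
  map_inf' := val_inf g h
  map_top' := val_top g h
  map_sSup' := val_sSup g h

/-- An element on which the two frame maps agree. -/
def mk (x : L) (hx : g x = h x) : FrameEqLocus g h :=
  ⟨x, hx⟩

/-- A frame map equalised by `g` and `h` factors through the subframe on which they agree. -/
def lift {N : Type u} [Order.Frame N] (k : FrameHom N L) (hk : ∀ n, g (k n) = h (k n)) :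
    FrameHom N (FrameEqLocus g h) where
  toFun n := mk g h (k n) (hk n)
  map_inf' a b := Subtype.ext (map_inf k a b)
  map_top' := Subtype.ext (map_top k)
  map_sSup' S := Subtype.ext ((map_sSup k S).trans
    (congrArg sSup (Set.image_image Subtype.val (fun n => mk g h (k n) (hk n)) S).symm))

end FrameEqLocus

namespace Locale

variable {X Y Z : Locale.{u}}

/-! ## Coequalisers -/

/-- The coequaliser of two maps of locales. -/
def coequaliser (f g : X ⟶ Y) : Locale.{u} :=
  of (FrameEqLocus (inv f) (inv g))

/-- The coequaliser map of two maps of locales. -/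
def coequaliserMap (f g : X ⟶ Y) : Y ⟶ coequaliser f g :=
  ofFrameHom (Y := coequaliser f g) (FrameEqLocus.subtype (inv f) (inv g))

theorem coequaliser_condition (f g : X ⟶ Y) :
    f ≫ coequaliserMap f g = g ≫ coequaliserMap f g :=
  hom_ext fun V => Subtype.property (p := fun x => inv f x = inv g x) V

/-- `coequaliserMap f g` is a coequaliser in the category of locales. -/
def coequaliserIsColimit (f g : X ⟶ Y) :
    IsColimit (Cofork.ofπ (coequaliserMap f g) (coequaliser_condition f g)) :=
  Cofork.IsColimit.mk _
    (fun c => ofFrameHom (X := coequaliser f g) (FrameEqLocus.lift (inv f) (inv g) (inv c.π)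
      fun V => show inv (f ≫ c.π) V = inv (g ≫ c.π) V by rw [c.condition]))
    (fun _ => rfl)
    (fun c m hm => hom_ext fun V => Subtype.ext (by
      change inv (coequaliserMap f g ≫ m) V = inv c.π V
      rw [← hm]
      rfl))

/-- The opens of a coequaliser are the opens on which the two frame maps agree. -/
theorem exists_inv_eq_of_isColimit {f g : X ⟶ Y} {q : Y ⟶ Z} {w : f ≫ q = g ≫ q}
    (hq : IsColimit (Cofork.ofπ q w)) {A : Y} (hA : inv f A = inv g A) :
    ∃ B : Z, inv q B = A := by
  -- The comparison map `d` to the explicit coequaliser carries `A`, which is an open there, back to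
  -- an open of `Z`.
  obtain ⟨d, hd⟩ := Cofork.IsColimit.desc' hq (coequaliserMap f g) (coequaliser_condition f g)
  let A' : coequaliser f g := FrameEqLocus.mk (inv f) (inv g) A hA
  refine ⟨inv d A', ?_⟩
  change inv (q ≫ d) A' = A
  have hd' : q ≫ d = coequaliserMap f g := hd
  rw [hd']
  rfl

/-! ## Maps through a sublocale -/

theorem restrict_le_iff (S : Sublocale X) (V : X) (D : S) : S.restrict V ≤ D ↔ V ≤ (D : X) :=
  S.giRestrict.gc.le_iff_le

/-- A map all of whose direct images lie in a sublocale factors through it. -/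
theorem exists_lift (S : Sublocale X) (k : Z ⟶ X) (hk : ∀ U, direct k U ∈ S) :
    ∃ l : Z ⟶ of S, l ≫ incl S = k := by
  -- Joins in `S` differ from those in `X`; `k⁻¹` restricted to `S` still preserves them because its
  -- right adjoint lands in `S`.
  have gc : GaloisConnection (fun s : S => inv k (s : X))
      (fun U => (⟨direct k U, hk U⟩ : S)) := fun s U => gc_inv_direct k (s : X) U
  let h : FrameHom S Z :=
    { toFun := fun s => inv k (s : X)
      map_inf' := fun a b => by rw [Sublocale.coe_inf, map_inf]
      map_top' := map_top (inv k)
      map_sSup' := fun B => by rw [sSup_image]; exact gc.l_sSup }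
  refine ⟨ofFrameHom (Y := of S) h, hom_ext fun V => ?_⟩
  change inv k (S.restrict V : X) = inv k V
  refine eq_of_forall_ge_iff fun U => ?_
  rw [gc_inv_direct k _ U, gc_inv_direct k _ U]
  exact restrict_le_iff S V ⟨_, hk U⟩

/-- Inequalities between opens restricted to a sublocale pull back along every map whose image
is contained in that sublocale. -/
theorem inv_le_inv_of_image_le {S : Sublocale X} {k : Z ⟶ X} (hk : image k ≤ S) {V W : X}
    (h : inv (incl S) V ≤ inv (incl S) W) : inv k V ≤ inv k W := by
  -- `k_* k⁻¹ W` is an element of `S` above `W`, hence above the reflection of `W` into `S`, and so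
  -- above `V`.
  have hm : direct k (inv k W) ∈ S := hk ((mem_image k _).2 ⟨_, rfl⟩)
  rw [gc_inv_direct k V]
  refine (restrict_le_iff S V ⟨_, hm⟩).1 (h.trans ?_)
  exact (restrict_le_iff S W ⟨_, hm⟩).2 ((gc_inv_direct k).le_u_l W)

/-! ## Closed sublocales -/

/-- The closed sublocale of opens above `W`. -/
def closedSublocale (W : X) : Sublocale X where
  carrier := Set.Ici W
  sInf_mem' _ hs := le_sInf fun _ hD => hs hD
  himp_mem' _ _ hb := le_trans hb le_himp

/-- Every sublocale is strongly dense in its closure. -/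
theorem stronglyDense_of_bot_le {A B : Sublocale X} (h : A ≤ B)
    (hb : ((⊥ : A) : X) ≤ ((⊥ : B) : X)) : StronglyDense (inclusion h) := by
  intro p
  -- For true `p` the bound is `⊤`; for false `p` only ordinary density remains.
  by_cases hp : p
  · refine le_top.trans ?_
    exact le_iSup (fun _ : p => (⊤ : of B)) hp
  · refine sSup_le fun V hV => ?_
    have e : truth (of A) p = ⊥ := by
      have : p = ⊥ := by simpa using hp
      rw [this, map_bot]
    have hV' : A.restrict (Subtype.val (p := (· ∈ B)) V) ≤ ⊥ := by
      change inv (inclusion h) V ≤ truth (of A) p at hV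
      rw [e] at hV
      exact hV
    rw [restrict_le_iff] at hV'
    have hV2 : (show B from V) ≤ ⊥ := hV'.trans hb
    exact le_trans (show V ≤ (⊥ : of B) from hV2) bot_le

/-- An invertible frame map is injective, and `b ∈ B` has the same restriction to `A` as its
reflection into `A`; so `b` equals that reflection. -/
theorem eq_of_isIso_inclusion {A B : Sublocale X} (h : A ≤ B) [IsIso (inclusion h)] : A = B := by
  refine le_antisymm h fun b hb => ?_
  have hinj : ∀ V W : B, inclusionHom h V = inclusionHom h W → V = W := by
    intro V W hVW
    have e : ∀ U : of B, inv (CategoryTheory.inv (inclusion h)) (inv (inclusion h) U) = U :=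
      fun U => show inv (CategoryTheory.inv (inclusion h) ≫ inclusion h) U = U by
        rw [IsIso.inv_hom_id]; rfl
    exact (e V).symm.trans ((congrArg (inv (CategoryTheory.inv (inclusion h))) hVW).trans (e W))
  have hr := hinj ⟨b, hb⟩ ⟨A.restrict b, h (A.restrict b).2⟩
    (Sublocale.restrict_of_mem (A.restrict b).2).symm
  have hr' : b = (A.restrict b : X) := congrArg Subtype.val hr
  rw [hr']
  exact (A.restrict b).2

/-- In classical logic, a weakly closed sublocale is closed. -/
theorem WeaklyClosed.mem {A : Sublocale X} (hA : WeaklyClosed A) {D : X}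
    (hD : ((⊥ : A) : X) ≤ D) : D ∈ A := by
  have h : A ≤ closedSublocale ((⊥ : A) : X) := fun a ha =>
    show ((⊥ : A) : X) ≤ a from (bot_le : (⊥ : A) ≤ ⟨a, ha⟩)
  have := hA _ h (stronglyDense_of_bot_le h
    (⊥ : closedSublocale ((⊥ : A) : X)).2)
  rw [eq_of_isIso_inclusion h]
  exact hD

/-! ## The Beck–Chevalley condition -/

/-- The Beck–Chevalley inequality for the pullback of an open map. -/
theorem inv_le_of_pullFst_le_pullSnd {f : X ⟶ Z} {g : Y ⟶ Z} {e : X → Z}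
    (he : GaloisConnection e (inv f)) (frob : ∀ U V, e (U ⊓ inv f V) = e U ⊓ V) {x : X} {y : Y}
    (h : inv (pullFst f g) x ≤ inv (pullSnd f g) y) : inv g (e x) ≤ y := by
  -- `D` is the open whose rectangles `a ⊗ b` satisfy `g⁻¹ (e a) ⊓ b ≤ y`. It contains `⊤ ⊗ y`; once
  -- it is known to lie in the pullback, the hypothesis forces it to contain `x ⊗ ⊤`, which is the
  -- claim.
  let D : FrameCoprod X Y := by
    refine ⟨⟨{p | inv g (e p.1) ⊓ p.2 ≤ y}, ?_⟩, ?_, ?_⟩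
    · intro p q hqp hp
      exact le_trans
        (inf_le_inf (OrderHomClass.mono (inv g) (he.monotone_l hqp.1)) hqp.2) hp
    · intro S b hS
      change inv g (e (sSup S)) ⊓ b ≤ y
      rw [he.l_sSup, map_iSup, iSup_inf_eq]
      refine iSup_le fun a => ?_
      rw [map_iSup, iSup_inf_eq]
      exact iSup_le fun ha => hS a ha
    · intro a T hT
      change inv g (e a) ⊓ sSup T ≤ y
      rw [inf_sSup_eq]
      exact iSup₂_le fun b hb => hT b hb
  -- On rectangles, saturation of `D` is exactly Frobenius reciprocity.
  have hD : (show prod X Y from D) ∈ pull f g := by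
    intro V c
    change FrameCoprod.inl (inv f V) ⊓ (show FrameCoprod X Y from c) ≤ D ↔
      FrameCoprod.inr (inv g V) ⊓ (show FrameCoprod X Y from c) ≤ D
    rw [FrameCoprod.eq_iSup_rect (show FrameCoprod X Y from c), inf_iSup₂_eq, inf_iSup₂_eq,
      iSup₂_le_iff, iSup₂_le_iff]
    refine forall₂_congr fun p _ => ?_
    change FrameCoprod.rect _ _ ⊓ _ ≤ D ↔ FrameCoprod.rect _ _ ⊓ _ ≤ D
    rw [FrameCoprod.rect_inf_rect, FrameCoprod.rect_inf_rect, FrameCoprod.rect_le_iff,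
      FrameCoprod.rect_le_iff]
    change inv g (e (inv f V ⊓ p.1)) ⊓ (⊤ ⊓ p.2) ≤ y ↔ inv g (e (⊤ ⊓ p.1)) ⊓ (inv g V ⊓ p.2) ≤ y
    rw [inf_comm (inv f V), frob, map_inf, top_inf_eq, top_inf_eq, inf_assoc]
  have h2 : inv (pullSnd f g) y ≤ (⟨D, hD⟩ : pull f g) := by
    refine (restrict_le_iff (pull f g) _ ⟨D, hD⟩).2 ?_
    change FrameCoprod.rect ⊤ y ≤ D
    rw [FrameCoprod.rect_le_iff]
    exact inf_le_right
  have h3 : FrameCoprod.rect x ⊤ ≤ D :=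
    (restrict_le_iff (pull f g) _ ⟨D, hD⟩).1 (h.trans h2)
  rw [FrameCoprod.rect_le_iff] at h3
  have h4 : inv g (e x) ⊓ ⊤ ≤ y := h3
  rwa [inf_top_eq] at h4

namespace Relation

/-! ## Localic equivalence relations -/

variable {R : Relation X}

theorem isQuotientMap_coequaliserMap (R : Relation X) :
    R.IsQuotientMap (coequaliserMap R.source R.target) :=
  ⟨coequaliser_condition _ _, ⟨coequaliserIsColimit _ _⟩⟩

/-- Reflexivity in terms of opens: the hypothesis is pulled back along the diagonal. -/
theorem le_of_inv_source_le_inv_target (hR : R.IsEquivalence) {U V : X}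
    (h : inv R.source U ≤ inv R.target V) : U ≤ V := by
  have h2 := inv_le_inv_of_image_le hR.refl (V := inv (fst X X) U) (W := inv (snd X X) V) h
  have e1 : inv (pair (𝟙 X) (𝟙 X) ≫ fst X X) U = U := by rw [pair_fst]; rfl
  have e2 : inv (pair (𝟙 X) (𝟙 X) ≫ snd X X) V = V := by rw [pair_snd]; rfl
  exact e1.symm.le.trans (h2.trans e2.le)

/-- Symmetry in terms of opens: the hypothesis is pulled back along `(t, s)`, whose image lies in
`R`. -/
theorem inv_target_le_inv_source (hR : R.IsEquivalence) {U V : X}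
    (h : inv R.source U ≤ inv R.target V) : inv R.target U ≤ inv R.source V := by
  have h2 := inv_le_inv_of_image_le (k := pair R.target R.source) hR.symm.ge
    (V := inv (fst X X) U) (W := inv (snd X X) V) h
  have e1 : inv (pair R.target R.source ≫ fst X X) U = inv R.target U := by rw [pair_fst]
  have e2 : inv (pair R.target R.source ≫ snd X X) V = inv R.source V := by rw [pair_snd]
  exact e1.symm.le.trans (h2.trans e2.le)

/-- Transitivity in terms of opens, in the form to which the Beck–Chevalley inequality applies. -/
theorem inv_pull_le_inv_pull (hR : R.IsEquivalence) {U V : X}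
    (h : inv R.source U ≤ inv R.target V) :
    inv (pullFst R.target R.source) (inv R.source U) ≤
      inv (pullSnd R.target R.source) (inv R.target V) := by
  have h2 := inv_le_inv_of_image_le hR.trans (V := inv (fst X X) U) (W := inv (snd X X) V) h
  have e1 := congrArg (fun k => inv k U) (pair_fst (pullFst R.target R.source ≫ R.source)
    (pullSnd R.target R.source ≫ R.target))
  have e2 := congrArg (fun k => inv k V) (pair_snd (pullFst R.target R.source ≫ R.source)
    (pullSnd R.target R.source ≫ R.target))
  exact e1.symm.le.trans (h2.trans e2.le)

/-- For an equivalence relation with open target map, the image under the target map of the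
inverse image of an open under the source map is saturated. -/
theorem inv_source_eq_inv_target (hR : R.IsEquivalence) {e : of R → X}
    (he : GaloisConnection e (inv R.target))
    (frob : ∀ U V, e (U ⊓ inv R.target V) = e U ⊓ V) (U : X) :
    inv R.source (e (inv R.source U)) = inv R.target (e (inv R.source U)) := by
  have h : inv R.source (e (inv R.source U)) ≤ inv R.target (e (inv R.source U)) :=
    inv_le_of_pullFst_le_pullSnd he frob
      (inv_pull_le_inv_pull hR (he.le_u_l (inv R.source U)))
  exact le_antisymm h (inv_target_le_inv_source hR h)

/-- A closed equivalence relation with open target map is the kernel pair of its quotient. -/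
theorem isKernelPair_of_closed (hR : R.IsEquivalence) (ht : IsOpenMap R.target)
    (hc : ∀ D, ((⊥ : R) : prod X X) ≤ D → D ∈ R) {Q : Locale.{u}} {q : X ⟶ Q}
    (hq : R.IsQuotientMap q) : IsKernelPair q R.source R.target := by
  obtain ⟨w, ⟨hcol⟩⟩ := hq
  obtain ⟨e, he, frob⟩ := ht
  have key : ∀ s : PullbackCone q q, ∃ l : s.pt ⟶ of R, l ≫ incl R = pair s.fst s.snd := by
    intro s
    -- As `R` is closed, it is enough that the pairing pulls the least element of `R` back to `⊥`,
    -- which is checked on rectangles.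
    refine exists_lift R _ fun U => hc _ ?_
    rw [← gc_inv_direct]
    refine le_trans (iSup₂_le fun p hp => ?_) (bot_le (a := U))
    have hp' : FrameCoprod.rect p.1 p.2 ≤ ((⊥ : R) : prod X X) :=
      (FrameCoprod.rect_le_iff _ _ _).2 hp
    have hst : inv R.source p.1 ⊓ inv R.target p.2 ≤ ⊥ := by
      have h1 := (restrict_le_iff R _ ⊥).2 hp'
      rw [← FrameCoprod.inl_inf_inr] at h1
      exact (R.restrict.map_inf' _ _).symm.le.trans h1
    have hA : e (inv R.source p.1) ⊓ p.2 ≤ ⊥ := by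
      rw [← frob]
      exact (he _ _).2 (hst.trans bot_le)
    -- The saturation of `p.1` descends to the quotient, where the two legs of the cone agree.
    obtain ⟨B, hB⟩ := exists_inv_eq_of_isColimit hcol (inv_source_eq_inv_target hR he frob p.1)
    have hle : p.1 ≤ inv q B := by
      rw [hB]
      exact le_of_inv_source_le_inv_target hR (he.le_u_l _)
    have hs : inv s.fst (inv q B) = inv s.snd (inv q B) :=
      show inv (s.fst ≫ q) B = inv (s.snd ≫ q) B by rw [s.condition]
    calc inv s.fst p.1 ⊓ inv s.snd p.2 ≤ inv s.fst (inv q B) ⊓ inv s.snd p.2 :=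
          inf_le_inf_right _ (OrderHomClass.mono (inv s.fst) hle)
      _ = inv s.snd (inv q B ⊓ p.2) := by rw [hs, map_inf]
      _ ≤ inv s.snd ⊥ := OrderHomClass.mono (inv s.snd) (by rw [hB]; exact hA)
      _ = ⊥ := map_bot _
  refine ⟨⟨w⟩, ⟨PullbackCone.IsLimit.mk _ (fun s => (key s).choose) ?_ ?_ ?_⟩⟩
  · intro s
    rw [source, ← Category.assoc, (key s).choose_spec, pair_fst]
  · intro s
    rw [target, ← Category.assoc, (key s).choose_spec, pair_snd]
  · intro s m h1 h2
    have := incl_mono R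
    rw [← cancel_mono (incl R), (key s).choose_spec]
    refine prod_hom_ext ?_ ?_
    · rw [pair_fst, ← h1, source, Category.assoc]
    · rw [pair_snd, ← h2, target, Category.assoc]

end Relation

end Locale

end

theorem mainTheorem4 (X : Locale.{u}) (R : Locale.Relation X) (hequiv : R.IsEquivalence)
    (hopen : R.HasOpenCones) (hclosed : Locale.WeaklyClosed R) :
    (∃ (Q : Locale.{u}) (q : X ⟶ Q), R.IsQuotientMap q) ∧
      ∀ (Q : Locale.{u}) (q : X ⟶ Q), R.IsQuotientMap q → IsKernelPair q R.source R.target :=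
  ⟨⟨_, _, R.isQuotientMap_coequaliserMap⟩, fun _ _ hq =>
    Locale.Relation.isKernelPair_of_closed hequiv hopen.2 (fun _ => hclosed.mem) hq⟩
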